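/- Let $n \ge 2$ and let $K \subset \mathbb{R}^n$ be a symmetric convex body, that is, a compact convex set with nonempty interior such that $-K = K$. For a symmetric convex body $L \subset \mathbb{R}^n$ and $N \ge n$, let $x_1, \dots, x_N$ be independent random points uniformly distributed in $L$ and put $$V_{L,N} = \frac{\operatorname{vol}_n\bigl(\operatorname{conv}\{\pm x_1, \dots, \pm x_N\}\bigr)}{\operatorname{vol}_n(L)}.$$ Let $v \in \mathbb{R}^n \setminus \{0\}$, let $\pi_v : \mathbb{R}^n \to v^\perp$ be the orthogonal projection, let $\beta : \pi_v(K) \to \mathbb{R}$ be odd ($\beta(-y) = -\beta(y)$), and let $I \subset \mathbb{R}$ be an interval that contains $0$ and has more than one point. Suppose that the sets $$K_t = \{x + t\,\beta(\pi_v(x))\,v : x \in K\}, \qquad t \in I,$$ are all convex; such a family is called an SRS-movement of $K$ with speed function $\beta$ (each $K_t$ is then again a symmetric convex body). Then for every real $p \ge 1$ and every integer $N \ge n$ the function $t \mapsto \mathbb{E}\, V_{K_t,N}^p$ is convex on $I$. Furthermore, for each such $p$ and $N$, this function is strictly convex on $I$ if and only if $\beta$ is not linear, that is, not the restriction to $\pi_v(K)$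 of a linear functional on $v^\perp$. -/

import Mathlib

open MeasureTheory ProbabilityTheory

open scoped Pointwise

noncomputable section

/-- Convex bodies that are symmetric about the origin: compact convex sets with interior points
and `-K = K`. -/
structure IsSymmetricConvexBody {n : ℕ} (K : Set (EuclideanSpace ℝ (Fin n))) : Prop where
  isCompact : IsCompact K
  convex : Convex ℝ K
  interior_nonempty : (interior K).Nonempty
  neg_eq : -K = K

/-- The hyperplane `v^⊥`. -/
abbrev perp {n : ℕ} (v : EuclideanSpace ℝ (Fin n)) :
    Submodule ℝ (EuclideanSpace ℝ (Fin n)) :=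
  (Submodule.span ℝ {v})ᗮ

/-- The orthogonal projection `π_v` onto `v^⊥`. -/
def projPerp {n : ℕ} (v : EuclideanSpace ℝ (Fin n)) :
    EuclideanSpace ℝ (Fin n) →L[ℝ] perp v :=
  (perp v).orthogonalProjectionOnto

/-- `K_t = {x + t β(π_v(x)) v : x ∈ K}`. Only the values of `β` on `π_v(K)` matter. -/
def movedBody {n : ℕ} (K : Set (EuclideanSpace ℝ (Fin n))) (v : EuclideanSpace ℝ (Fin n))
    (β : perp v → ℝ) (t : ℝ) : Set (EuclideanSpace ℝ (Fin n)) :=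
  (fun x => x + (t * β (projPerp v x)) • v) '' K

/-- The sets `K_t`, `t ∈ I`, form an RS-movement of `K` in direction `v` with speed function
`β` on `π_v(K)`. -/
structure IsRSMovement {n : ℕ} (K : Set (EuclideanSpace ℝ (Fin n)))
    (v : EuclideanSpace ℝ (Fin n)) (β : perp v → ℝ) (I : Set ℝ) : Prop where
  direction_ne_zero : v ≠ 0
  interval : I.OrdConnected
  zero_mem : (0 : ℝ) ∈ I
  convex_movedBody : ∀ t ∈ I, Convex ℝ (movedBody K v β t)

/-- An RS-movement whose speed function is odd on `π_v(K)`. -/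
structure IsSRSMovement {n : ℕ} (K : Set (EuclideanSpace ℝ (Fin n)))
    (v : EuclideanSpace ℝ (Fin n)) (β : perp v → ℝ) (I : Set ℝ) : Prop
    extends IsRSMovement K v β I where
  odd : ∀ y ∈ projPerp v '' K, β (-y) = -β y

/-- The speed function is linear on `π_v(K)`: it is the restriction of a linear functional
on `v^⊥`. -/
def IsLinearSpeed {n : ℕ} (K : Set (EuclideanSpace ℝ (Fin n)))
    (v : EuclideanSpace ℝ (Fin n)) (β : perp v → ℝ) : Prop :=
  ∃ l : perp v →ₗ[ℝ] ℝ, ∀ y ∈ projPerp v '' K, β y = l y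

/-- `V_{K,N}` as a function of the sample points: the normalized volume of
`conv {± x_1, …, ± x_N}`. -/
def symHullVolume {n N : ℕ} (K : Set (EuclideanSpace ℝ (Fin n)))
    (x : Fin N → EuclideanSpace ℝ (Fin n)) : ℝ :=
  volume.real (convexHull ℝ (Set.range x ∪ Set.range (-x))) / volume.real K

/-- `E V_{K,N}^p`: the `p`-th moment of `V_{K,N}` for `N` independent points, each uniformly
distributed in `K`. -/
def symMoment {n : ℕ} (K : Set (EuclideanSpace ℝ (Fin n))) (N : ℕ) (p : ℝ) : ℝ :=
  ∫ x : Fin N → EuclideanSpace ℝ (Fin n), symHullVolume K x ^ p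
    ∂(Measure.pi fun _ => cond volume K)

end

/-!
Let `x₁, …, x_N` be uniform in `K` and move every `x_i` along its line parallel to `v`, to
`x_i + t β(π_v x_i) v`. By Cavalieri the moved points are uniform in `K_t` and `vol K_t = vol K`,
so `E V_{K_t,N}^p` is the average over `(x_i)`, with respect to a measure that does not depend on
`t`, of the `p`-th power of the normalized volume of the moving hull. For fixed `x_i` this hull is
the image of a fixed polytope in `ℝⁿ × ℝ` under the maps `(x, r) ↦ x + t r v`. Its chords parallel
to `v` obey a one-dimensional Brunn–Minkowski inequality in `t`, which makes its volume convex in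
`t`; hence so is the moment. A linear `β` moves every hull by shears of determinant one, so the
moment is then constant.

If `β` is not linear, then for each time `c` there are `n` points of `K` which the motion puts into
a common hyperplane through `0` at time `c` and at no other time. Indeed `β` already fails to be
linear on the shadow of the interior of `K`, so some `y` there and a basis of `v^⊥` arbitrarily
close to `0` violate the linear relation between `y` and the basis vectors; lift `y` and the basis
vectors to `K` so that at time `c` they lie on the graph of a linear functional. Put the remaining
sample points at `0`. The volume of the moving hull vanishes exactly at `t = c`, so the convexity
inequality at `c` is strict. By semicontinuity of the hull volume it stays strict for all nearby
samples, which form a set of positive measure.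
-/

open Set Filter Topology

/-- The symmetric convex hull `conv {± x i}` of a family of points. -/
def symHull {ι M : Type*} [AddCommGroup M] [Module ℝ M] (x : ι → M) : Set M :=
  convexHull ℝ (range x ∪ range (-x))

section SymHull

variable {ι κ M M' : Type*} [AddCommGroup M] [Module ℝ M] [AddCommGroup M'] [Module ℝ M']

theorem convex_symHull (x : ι → M) : Convex ℝ (symHull x) :=
  convex_convexHull ℝ _

theorem mem_symHull (x : ι → M) (i : ι) : x i ∈ symHull x :=
  subset_convexHull ℝ _ (.inl (mem_range_self i))

theorem neg_mem_symHull (x : ι → M) (i : ι) : -x i ∈ symHull x :=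
  subset_convexHull ℝ _ (.inr (mem_range_self i))

theorem symHull_subset {x : ι → M} {s : Set M} (hs : Convex ℝ s) (hx : ∀ i, x i ∈ s)
    (hx' : ∀ i, -x i ∈ s) : symHull x ⊆ s :=
  convexHull_min (union_subset (range_subset_iff.2 hx) (range_subset_iff.2 hx')) hs

theorem symHull_comp_subset (x : ι → M) (e : κ → ι) : symHull (x ∘ e) ⊆ symHull x :=
  symHull_subset (convex_symHull x) (fun i => mem_symHull x (e i)) fun i => neg_mem_symHull x (e i)

theorem symHull_subset_submodule {x : ι → M} {H : Submodule ℝ M} (hx : ∀ i, x i ∈ H) :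
    symHull x ⊆ H :=
  symHull_subset H.convex hx fun i => H.neg_mem (hx i)

theorem image_symHull (f : M →ₗ[ℝ] M') (x : ι → M) : f '' symHull x = symHull (f ∘ x) := by
  rw [symHull, f.image_convexHull, image_union, ← range_comp, ← range_comp, symHull]
  congr
  ext i
  simp

theorem isCompact_symHull [Finite ι] [TopologicalSpace M] [IsTopologicalAddGroup M]
    [ContinuousSMul ℝ M] (x : ι → M) : IsCompact (symHull x) :=
  ((finite_range x).union (finite_range (-x))).isCompact_convexHull ℝ

end SymHull

section HullVolume

variable {ι E : Type*} [NormedAddCommGroup E] [NormedSpace ℝ E]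

theorem eventually_symHull_subset [Finite ι] {x : ι → E} {W : Set E} (hW : IsOpen W)
    (hx : symHull x ⊆ W) : ∀ᶠ x' in 𝓝 x, symHull x' ⊆ W := by
  obtain ⟨δ, hδ, hδW⟩ := (isCompact_symHull x).exists_thickening_subset_open hW hx
  have hnhds {y : E} (hy : y ∈ symHull x) : Metric.thickening δ (symHull x) ∈ 𝓝 y :=
    Metric.isOpen_thickening.mem_nhds (Metric.self_subset_thickening hδ _ hy)
  have hpos : ∀ᶠ x' in 𝓝 x, ∀ i, x' i ∈ Metric.thickening δ (symHull x) :=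
    eventually_all.2 fun i => (continuous_apply i).continuousAt (hnhds (mem_symHull x i))
  have hneg : ∀ᶠ x' in 𝓝 x, ∀ i, -x' i ∈ Metric.thickening δ (symHull x) :=
    eventually_all.2 fun i =>
      (continuous_apply i).neg.continuousAt (hnhds (neg_mem_symHull x i))
  filter_upwards [hpos, hneg] with x' hx' hx''
  exact (symHull_subset ((convex_symHull x).thickening δ) hx' hx'').trans hδW

variable [MeasurableSpace E]

theorem upperSemicontinuous_measure_symHull [Finite ι] (μ : Measure E) [μ.OuterRegular] :
    UpperSemicontinuous fun x : ι → E => μ (symHull x) := by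
  intro x r hr
  obtain ⟨W, hxW, hW, hWr⟩ := (symHull x).exists_isOpen_lt_of_lt r hr
  filter_upwards [eventually_symHull_subset hW hxW] with x' hx'
  exact (measure_mono hx').trans_lt hWr

theorem measureReal_symHull_basis_pos [Finite ι] [Nonempty ι] [FiniteDimensional ℝ E]
    (μ : Measure E) [μ.IsAddHaarMeasure] (b : Module.Basis ι ℝ E) :
    0 < μ.real (symHull b) := by
  have hspan : affineSpan ℝ (range b ∪ range (-⇑b)) = ⊤ := by
    rw [AffineSubspace.affineSpan_eq_top_iff_vectorSpan_eq_top_of_nonempty _ _ _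
      ((range_nonempty b).inl), eq_top_iff, ← b.span_eq, Submodule.span_le]
    rintro _ ⟨i, rfl⟩
    have htwo : b i -ᵥ -b i ∈ vectorSpan ℝ (range b ∪ range (-⇑b)) :=
      vsub_mem_vectorSpan ℝ (.inl (mem_range_self i)) (.inr (mem_range_self (f := -⇑b) i))
    simpa [← two_smul ℝ (b i)] using Submodule.smul_mem _ (2⁻¹ : ℝ) htwo
  have hint : (interior (symHull b)).Nonempty :=
    interior_convexHull_nonempty_iff_affineSpan_eq_top.2 hspan
  exact ENNReal.toReal_pos (Measure.measure_pos_of_nonempty_interior μ hint).ne'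
    (isCompact_symHull _).measure_ne_top

variable [BorelSpace E] [FiniteDimensional ℝ E]

theorem measurable_measureReal_symHull [Finite ι] (μ : Measure E) [μ.OuterRegular] :
    Measurable fun x : ι → E => μ.real (symHull x) :=
  (upperSemicontinuous_measure_symHull μ).measurable.ennreal_toReal

variable (μ : Measure E) [μ.IsAddHaarMeasure]

theorem measureReal_symHull_eq_mul_abs_det [Fintype ι] [DecidableEq ι] (b : Module.Basis ι ℝ E)
    (x : ι → E) : μ.real (symHull x) = μ.real (symHull b) * |b.det x| := by
  have himage : symHull x = b.constr ℝ x '' symHull b := by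
    rw [image_symHull]
    congr
    ext i
    simp
  have hdet : LinearMap.det (b.constr ℝ x) = b.det x := by
    simpa [Function.comp_def, b.det_self] using (b.det_comp (b.constr ℝ x) b).symm
  rw [himage, measureReal_def, Measure.addHaar_image_linearMap, hdet, ENNReal.toReal_mul,
    ENNReal.toReal_ofReal (abs_nonneg _), mul_comm, measureReal_def]

theorem continuous_measureReal_symHull [Finite ι] (b : Module.Basis ι ℝ E) :
    Continuous fun x : ι → E => μ.real (symHull x) := by
  classical
  have := Fintype.ofFinite ι
  have hdet : Continuous fun x : ι → E => b.det x :=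
    Continuous.matrix_det <| continuous_matrix fun i j =>
      (b.coord i).continuous_of_finiteDimensional.comp (continuous_apply j)
  exact (continuous_const.mul hdet.abs).congr fun x =>
    (measureReal_symHull_eq_mul_abs_det μ b x).symm

theorem measure_symHull_eq_zero {x : ι → E} {H : Submodule ℝ E} (hH : H ≠ ⊤)
    (hx : ∀ i, x i ∈ H) : μ (symHull x) = 0 :=
  measure_mono_null (symHull_subset_submodule hx) (Measure.addHaar_submodule μ H hH)

theorem eventually_measureReal_symHull_lt_mul {α κ : Type*} [Finite ι] [Finite κ] [Nonempty κ]
    {F : Filter α} {f g : α → ι → E} {f₀ g₀ : ι → E} (hf : Tendsto f F (𝓝 f₀))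
    (hg : Tendsto g F (𝓝 g₀)) {H : Submodule ℝ E} (hH : H ≠ ⊤) (hf₀ : ∀ i, f₀ i ∈ H)
    (b : Module.Basis κ ℝ E) {e : κ → ι} (hg₀ : g₀ ∘ e = b) {l : ℝ} (hl : 0 < l) :
    ∀ᶠ a in F, μ.real (symHull (f a)) < l * μ.real (symHull (g a)) := by
  have hpos : 0 < μ.real (symHull (g₀ ∘ e)) := hg₀ ▸ measureReal_symHull_basis_pos μ b
  have hsub : Tendsto (fun a => μ.real (symHull (g a ∘ e))) F (𝓝 (μ.real (symHull (g₀ ∘ e)))) :=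
    ((continuous_measureReal_symHull μ b).tendsto _).comp
      (tendsto_pi_nhds.2 fun k => tendsto_pi_nhds.1 hg (e k))
  obtain ⟨δ, hδ, hδl⟩ := exists_between (mul_pos hl hpos)
  have hsmall : ∀ᶠ a in F, μ (symHull (f a)) < ENNReal.ofReal δ := by
    refine hf.eventually (upperSemicontinuous_measure_symHull μ f₀ _ ?_)
    simpa only [measure_symHull_eq_zero μ hH hf₀, ENNReal.ofReal_pos] using hδ
  filter_upwards [hsmall, (hsub.const_mul l).eventually_const_lt hδl] with a hfa hga
  calc μ.real (symHull (f a)) < δ := ENNReal.toReal_lt_of_lt_ofReal hfa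
    _ < l * μ.real (symHull (g a ∘ e)) := hga
    _ ≤ l * μ.real (symHull (g a)) := by
      gcongr
      · exact (isCompact_symHull _).measure_ne_top
      · exact symHull_comp_subset (g a) e

end HullVolume

section Shadow

theorem volume_smul_add_smul_le {A B : Set ℝ} (hA : A.OrdConnected) (hB : B.OrdConnected)
    {l m : ℝ} (hl : 0 ≤ l) (hm : 0 ≤ m) :
    volume (l • A + m • B) ≤ ENNReal.ofReal l * volume A + ENNReal.ofReal m * volume B := by
  have hdist {S : Set ℝ} (hS : S.OrdConnected) {x x' : ℝ} (hx : x ∈ S) (hx' : x' ∈ S) :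
      ENNReal.ofReal |x - x'| ≤ volume S := by
    rw [← Real.volume_interval]
    exact measure_mono (hS.uIcc_subset hx' hx)
  refine (Real.volume_le_diam _).trans (Metric.ediam_le ?_)
  rintro _ ⟨_, ⟨x, hx, rfl⟩, _, ⟨y, hy, rfl⟩, rfl⟩ _ ⟨_, ⟨x', hx', rfl⟩, _, ⟨y', hy', rfl⟩, rfl⟩
  calc edist (l • x + m • y) (l • x' + m • y')
      ≤ edist (l • x) (l • x') + edist (m • y) (m • y') := edist_add_add_le _ _ _ _
    _ = ENNReal.ofReal l * ENNReal.ofReal |x - x'| +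
          ENNReal.ofReal m * ENNReal.ofReal |y - y'| := by
        simp only [edist_dist, Real.dist_eq, smul_eq_mul, ← mul_sub, abs_mul, abs_of_nonneg hl,
          abs_of_nonneg hm, ENNReal.ofReal_mul hl, ENNReal.ofReal_mul hm]
    _ ≤ ENNReal.ofReal l * volume A + ENNReal.ofReal m * volume B := by
        gcongr
        exacts [hdist hA hx hx', hdist hB hy hy']

/-- The map `(x, r) ↦ x + t r v`. The images of a convex set in `M × ℝ` under these maps, as `t`
varies, form a shadow system in direction `v`. -/
def shadowMap {M : Type*} [AddCommGroup M] [Module ℝ M] (v : M) (t : ℝ) : M × ℝ →ₗ[ℝ] M :=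
  LinearMap.id.coprod (t • LinearMap.toSpanSingleton ℝ M v)

theorem shadowMap_apply {M : Type*} [AddCommGroup M] [Module ℝ M] (v : M) (t : ℝ) (q : M × ℝ) :
    shadowMap v t q = q.1 + (t * q.2) • v := by
  simp [shadowMap, mul_smul]

theorem prod_image_shadowMap_le {F : Type*} [NormedAddCommGroup F] [NormedSpace ℝ F]
    [FiniteDimensional ℝ F] [MeasurableSpace F] [BorelSpace F] (ν : Measure F) [SFinite ν]
    {C : Set ((F × ℝ) × ℝ)} (hC : IsCompact C) (hconv : Convex ℝ C) {l m : ℝ} (hl : 0 ≤ l)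
    (hm : 0 ≤ m) (hlm : l + m = 1) (a b : ℝ) :
    (ν.prod volume) (shadowMap (0, 1) (l * a + m * b) '' C) ≤
      ENNReal.ofReal l * (ν.prod volume) (shadowMap (0, 1) a '' C) +
        ENNReal.ofReal m * (ν.prod volume) (shadowMap (0, 1) b '' C) := by
  have hmeas (t : ℝ) : MeasurableSet (shadowMap ((0 : F), (1 : ℝ)) t '' C) :=
    (hC.image (shadowMap _ t).continuous_of_finiteDimensional).measurableSet
  have hord (t : ℝ) (y : F) : (Prod.mk y ⁻¹' (shadowMap (0, 1) t '' C)).OrdConnected := by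
    have hline : Prod.mk y = AffineMap.lineMap (k := ℝ) (y, (0 : ℝ)) (y, 1) := by
      ext s <;> simp [AffineMap.lineMap_apply]
    rw [hline]
    exact ((hconv.linear_image _).affine_preimage _).ordConnected
  have hfiber (y : F) : Prod.mk y ⁻¹' (shadowMap (0, 1) (l * a + m * b) '' C) ⊆
      l • (Prod.mk y ⁻¹' (shadowMap (0, 1) a '' C)) +
        m • (Prod.mk y ⁻¹' (shadowMap (0, 1) b '' C)) := by
    rintro z ⟨⟨⟨y', s⟩, r⟩, hq, hz⟩
    obtain ⟨rfl, rfl⟩ : y' = y ∧ s + (l * a + m * b) * r = z := by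
      simpa [shadowMap_apply, Prod.ext_iff] using hz
    have hmem (t : ℝ) : s + t * r ∈ Prod.mk y' ⁻¹' (shadowMap (0, 1) t '' C) :=
      ⟨_, hq, by simp [shadowMap_apply]⟩
    refine ⟨_, ⟨_, hmem a, rfl⟩, _, ⟨_, hmem b, rfl⟩, ?_⟩
    simp only [smul_eq_mul]
    linear_combination s * hlm
  simp only [Measure.prod_apply (hmeas _)]
  rw [← lintegral_const_mul _ (measurable_measure_prodMk_left (hmeas a)),
    ← lintegral_const_mul _ (measurable_measure_prodMk_left (hmeas b)),
    ← lintegral_add_left ((measurable_measure_prodMk_left (hmeas a)).const_mul _)]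
  exact lintegral_mono fun y => (measure_mono (hfiber y)).trans
    (volume_smul_add_smul_le (hord a y) (hord b y) hl hm)

variable {E : Type*} [NormedAddCommGroup E] [NormedSpace ℝ E] [FiniteDimensional ℝ E]
  [MeasurableSpace E] [BorelSpace E] (μ : Measure E) [μ.IsAddHaarMeasure]

theorem exists_measurePreserving_prod_line {v : E} (hv : v ≠ 0) :
    ∃ (F : Submodule ℝ E) (ν : Measure F) (_ : SFinite ν) (Φ : (F × ℝ) ≃L[ℝ] E),
      (∀ q, Φ q = q.1 + q.2 • v) ∧ MeasurePreserving Φ (ν.prod volume) μ := by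
  obtain ⟨F, hF⟩ := Submodule.exists_isCompl (Submodule.span ℝ {v})
  let Φ : (F × ℝ) ≃L[ℝ] E :=
    (((LinearEquiv.refl ℝ F).prodCongr (LinearEquiv.toSpanNonzeroSingleton ℝ E v hv)).trans
      (F.prodEquivOfIsCompl _ hF.symm)).toContinuousLinearEquiv
  obtain ⟨c, hc⟩ : ∃ c : NNReal, μ = c • ((Measure.addHaar : Measure F).prod volume).map Φ :=
    ⟨_, Measure.isAddLeftInvariant_eq_smul _ _⟩
  refine ⟨F, c • Measure.addHaar, inferInstance, Φ, fun q => rfl, Φ.continuous.measurable, ?_⟩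
  rw [Measure.prod_smul_left, Measure.map_smul, ← hc]

theorem measure_image_shadowMap_le (v : E) {C : Set (E × ℝ)} (hC : IsCompact C)
    (hconv : Convex ℝ C) {l m : ℝ} (hl : 0 ≤ l) (hm : 0 ≤ m) (hlm : l + m = 1) (a b : ℝ) :
    μ (shadowMap v (l * a + m * b) '' C) ≤
      ENNReal.ofReal l * μ (shadowMap v a '' C) + ENNReal.ofReal m * μ (shadowMap v b '' C) := by
  rcases eq_or_ne v 0 with rfl | hv
  · have hconst (t : ℝ) : shadowMap (0 : E) t = shadowMap 0 0 := by
      ext <;> simp [shadowMap_apply]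
    rw [hconst, hconst a, hconst b, ← add_mul, ← ENNReal.ofReal_add hl hm, hlm,
      ENNReal.ofReal_one, one_mul]
  obtain ⟨F, ν, _, Φ, hΦ, hmp⟩ := exists_measurePreserving_prod_line μ hv
  let Ψ : (E × ℝ) ≃L[ℝ] ((F × ℝ) × ℝ) := Φ.symm.prodCongr (.refl ℝ ℝ)
  have hshadow (t : ℝ) : μ (shadowMap v t '' C) =
      (ν.prod volume) (shadowMap (0, 1) t '' (Ψ '' C)) := by
    have hv' : v = Φ (0, 1) := by simp [hΦ]
    rw [← hmp.measure_preimage_equiv (f := Φ.toHomeomorph.toMeasurableEquiv)]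
    congr 1
    change Φ ⁻¹' _ = _
    rw [← Φ.image_symm_eq_preimage, image_image, image_image]
    refine image_congr fun q _ => ?_
    simp [shadowMap_apply, hv', Ψ]
  simp only [hshadow]
  exact prod_image_shadowMap_le ν (hC.image Ψ.continuous)
    (hconv.linear_image Ψ.toLinearEquiv.toLinearMap) hl hm hlm a b

theorem convexOn_measureReal_image_shadowMap (v : E) {C : Set (E × ℝ)} (hC : IsCompact C)
    (hconv : Convex ℝ C) : ConvexOn ℝ univ fun t => μ.real (shadowMap v t '' C) := by
  refine ⟨convex_univ, fun a _ b _ l m hl hm hlm => ?_⟩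
  have hfin (t : ℝ) : μ (shadowMap v t '' C) ≠ ⊤ :=
    (hC.image (shadowMap v t).continuous_of_finiteDimensional).measure_ne_top
  have hle := ENNReal.toReal_mono (by finiteness [hfin a, hfin b])
    (measure_image_shadowMap_le μ v hC hconv hl hm hlm a b)
  rwa [ENNReal.toReal_add (by finiteness [hfin a]) (by finiteness [hfin b]), ENNReal.toReal_mul,
    ENNReal.toReal_mul, ENNReal.toReal_ofReal hl, ENNReal.toReal_ofReal hm] at hle

theorem convexOn_measureReal_symHull_add_smul {ι : Type*} [Finite ι] (v : E) (x : ι → E)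
    (r : ι → ℝ) : ConvexOn ℝ univ fun t => μ.real (symHull fun i => x i + (t * r i) • v) := by
  refine (convexOn_measureReal_image_shadowMap μ v (isCompact_symHull fun i => (x i, r i))
    (convex_symHull _)).congr fun t _ => congrArg μ.real ((image_symHull _ _).trans ?_)
  simp only [Function.comp_def, shadowMap_apply]

theorem measurePreserving_add_smul {v : E} {φ : E → ℝ} (hφ : Measurable φ)
    (hinv : ∀ x (s : ℝ), φ (x + s • v) = φ x) :
    MeasurePreserving (fun x => x + φ x • v) μ μ := by
  rcases eq_or_ne v 0 with rfl | hv
  · simpa [Function.id_def] using MeasurePreserving.id μ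
  obtain ⟨F, ν, _, Φ, hΦ, hmp⟩ := exists_measurePreserving_prod_line μ hv
  have hskew : MeasurePreserving (fun q : F × ℝ => (q.1, q.2 + φ q.1)) (ν.prod volume)
      (ν.prod volume) :=
    (MeasurePreserving.id ν).skew_product (g := fun y s => s + φ y) (by fun_prop)
      (.of_forall fun y => (measurePreserving_add_right volume (φ y)).map_eq)
  have hmp_symm : MeasurePreserving Φ.symm μ (ν.prod volume) :=
    hmp.symm Φ.toHomeomorph.toMeasurableEquiv
  convert hmp.comp (hskew.comp hmp_symm) using 1
  ext1 x
  obtain ⟨q, rfl⟩ := Φ.surjective x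
  simp only [Function.comp_apply, Φ.symm_apply_apply]
  simp only [hΦ, hinv, add_smul, add_assoc]

end Shadow

section IntegralConvexity

variable {α E : Type*} [AddCommGroup E] [Module ℝ E] {s : Set E}

theorem convexOn_rpow_of_nonneg {f : E → ℝ} {p : ℝ} (hp : 1 ≤ p) (hf : ConvexOn ℝ s f)
    (hf₀ : ∀ x, 0 ≤ f x) : ConvexOn ℝ s fun x => f x ^ p := by
  refine ⟨hf.1, fun x hx y hy l r hl hr hlr => ?_⟩
  exact (Real.rpow_le_rpow (hf₀ _) (hf.2 hx hy hl hr hlr) (by positivity)).trans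
    ((convexOn_rpow hp).2 (hf₀ x) (hf₀ y) hl hr hlr)

variable [MeasurableSpace α] {μ : Measure α} {f : E → α → ℝ}

theorem convexOn_integral (hs : Convex ℝ s) (hf : ∀ᵐ a ∂μ, ConvexOn ℝ s (f · a))
    (hint : ∀ x ∈ s, Integrable (f x) μ) : ConvexOn ℝ s fun x => ∫ a, f x a ∂μ := by
  refine ⟨hs, fun x hx y hy l r hl hr hlr => ?_⟩
  simp only [smul_eq_mul, ← integral_const_mul]
  rw [← integral_add ((hint x hx).const_mul l) ((hint y hy).const_mul r)]
  refine integral_mono_ae (hint _ (hs hx hy hl hr hlr))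
    (((hint x hx).const_mul l).add ((hint y hy).const_mul r)) ?_
  filter_upwards [hf] with a ha using ha.2 hx hy hl hr hlr

theorem strictConvexOn_integral (hs : Convex ℝ s) (hf : ∀ᵐ a ∂μ, ConvexOn ℝ s (f · a))
    (hint : ∀ x ∈ s, Integrable (f x) μ)
    (hlt : ∀ x ∈ s, ∀ y ∈ s, x ≠ y → ∀ l r : ℝ, 0 < l → 0 < r → l + r = 1 →
      ∃ᶠ a in ae μ, f (l • x + r • y) a < l * f x a + r * f y a) :
    StrictConvexOn ℝ s fun x => ∫ a, f x a ∂μ := by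
  refine ⟨hs, fun x hx y hy hxy l r hl hr hlr => ?_⟩
  simp only [smul_eq_mul, ← integral_const_mul]
  have hint' := ((hint x hx).const_mul l).add ((hint y hy).const_mul r)
  have hintz := hint _ (hs hx hy hl.le hr.le hlr)
  have hle : f (l • x + r • y) ≤ᵐ[μ] fun a => l * f x a + r * f y a := by
    filter_upwards [hf] with a ha using ha.2 hx hy hl.le hr.le hlr
  rw [← integral_add ((hint x hx).const_mul l) ((hint y hy).const_mul r)]
  refine (integral_mono_ae hintz hint' hle).lt_of_ne fun heq => ?_
  have hae := (integral_eq_iff_of_ae_le hintz hint' hle).1 heq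
  exact hlt x hx y hy hxy l r hl hr hlr (hae.mono fun a ha => ha.not_lt)

end IntegralConvexity

section Shear

variable {n : ℕ} {v : EuclideanSpace ℝ (Fin n)}

@[simp]
theorem projPerp_self (v : EuclideanSpace ℝ (Fin n)) : projPerp v v = 0 :=
  Submodule.orthogonalProjectionOnto_orthogonalComplement_singleton_eq_zero v

@[simp]
theorem projPerp_coe (y : perp v) : projPerp v (y : EuclideanSpace ℝ (Fin n)) = y :=
  Submodule.orthogonalProjectionOnto_mem_subspace_eq_self y

theorem projPerp_surjective (v : EuclideanSpace ℝ (Fin n)) : Function.Surjective (projPerp v) :=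
  fun y => ⟨y, projPerp_coe y⟩

theorem projPerp_coe_add_smul (y : perp v) (s : ℝ) :
    projPerp v ((y : EuclideanSpace ℝ (Fin n)) + s • v) = y := by
  rw [map_add, map_smul, projPerp_coe, projPerp_self, smul_zero, add_zero]

theorem exists_eq_projPerp_add_smul (v x : EuclideanSpace ℝ (Fin n)) :
    ∃ s : ℝ, x = projPerp v x + s • v := by
  have hdecomp := (Submodule.span ℝ {v}).starProjection_add_starProjection_orthogonal x
  rw [Submodule.starProjection_singleton, add_comm] at hdecomp
  exact ⟨_, hdecomp.symm⟩

/-- The shear `x ↦ x + t β(π_v x) v`, so that `movedBody K v β t` is the image of `K`. -/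
noncomputable def shear (v : EuclideanSpace ℝ (Fin n)) (β : perp v → ℝ) (t : ℝ)
    (x : EuclideanSpace ℝ (Fin n)) : EuclideanSpace ℝ (Fin n) :=
  x + (t * β (projPerp v x)) • v

@[simp]
theorem projPerp_shear (β : perp v → ℝ) (t : ℝ) (x : EuclideanSpace ℝ (Fin n)) :
    projPerp v (shear v β t x) = projPerp v x := by
  simp [shear]

theorem shear_coe_add_smul (β : perp v → ℝ) (t : ℝ) (y : perp v) (s : ℝ) :
    shear v β t ((y : EuclideanSpace ℝ (Fin n)) + s • v) = y + (s + t * β y) • v := by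
  rw [shear, projPerp_coe_add_smul, add_assoc, ← add_smul]

theorem shear_shear (β : perp v → ℝ) (s t : ℝ) (x : EuclideanSpace ℝ (Fin n)) :
    shear v β s (shear v β t x) = shear v β (s + t) x := by
  rw [shear, projPerp_shear, shear, shear, add_assoc, ← add_smul, add_mul, add_comm (t * _)]

@[simp]
theorem shear_zero (β : perp v → ℝ) (x : EuclideanSpace ℝ (Fin n)) : shear v β 0 x = x := by
  simp [shear]

theorem movedBody_eq_preimage_shear (K : Set (EuclideanSpace ℝ (Fin n))) (β : perp v → ℝ) (t : ℝ) :
    movedBody K v β t = shear v β (-t) ⁻¹' K :=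
  congrFun (image_eq_preimage_of_inverse (f := shear v β t) (g := shear v β (-t))
    (fun x => by rw [shear_shear, neg_add_cancel, shear_zero])
      fun x => by rw [shear_shear, add_neg_cancel, shear_zero]) K

theorem measurePreserving_shear {β : perp v → ℝ} (hβ : Measurable β) (t : ℝ) :
    MeasurePreserving (shear v β t) :=
  measurePreserving_add_smul volume ((hβ.comp (projPerp v).measurable).const_mul t)
    fun x s => by simp

theorem convexOn_volume_symHull_shear {ι : Type*} [Finite ι] (β : perp v → ℝ)
    (x : ι → EuclideanSpace ℝ (Fin n)) :
    ConvexOn ℝ univ fun t => volume.real (symHull fun i => shear v β t (x i)) :=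
  convexOn_measureReal_symHull_add_smul volume v x fun i => β (projPerp v (x i))

theorem convexOn_symHullVolume_shear_rpow {N : ℕ} {p : ℝ} (hp : 1 ≤ p)
    (K : Set (EuclideanSpace ℝ (Fin n))) (β : perp v → ℝ)
    (x : Fin N → EuclideanSpace ℝ (Fin n)) :
    ConvexOn ℝ univ fun t => symHullVolume K (fun i => shear v β t (x i)) ^ p := by
  refine convexOn_rpow_of_nonneg hp ?_ fun t => div_nonneg measureReal_nonneg measureReal_nonneg
  exact ((convexOn_volume_symHull_shear β x).smul (inv_nonneg.2 measureReal_nonneg)).congr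
    fun t _ => (div_eq_inv_mul _ _).symm

theorem volume_symHull_shear_of_linear {ι : Type*} [Finite ι] (l : perp v →ₗ[ℝ] ℝ) (t : ℝ)
    (x : ι → EuclideanSpace ℝ (Fin n)) :
    volume.real (symHull fun i => shear v l t (x i)) = volume.real (symHull x) := by
  let T : EuclideanSpace ℝ (Fin n) →ₗ[ℝ] EuclideanSpace ℝ (Fin n) :=
    LinearMap.id + ((t • l) ∘ₗ (projPerp v).toLinearMap).smulRight v
  have hT : ⇑T = shear v l t := by
    ext1 x
    simp [T, shear]
  have himage : (symHull fun i => shear v l t (x i)) = shear v l (-t) ⁻¹' symHull x := by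
    rw [← movedBody_eq_preimage_shear, ← Function.comp_def, ← hT, ← image_symHull, hT]
    rfl
  rw [himage, (measurePreserving_shear
    l.continuous_of_finiteDimensional.measurable (-t)).measureReal_preimage
    (isCompact_symHull x).measurableSet.nullMeasurableSet]

end Shear

section MovedBody

variable {n N : ℕ} {K : Set (EuclideanSpace ℝ (Fin n))} {v : EuclideanSpace ℝ (Fin n)}
  {β b : perp v → ℝ}

theorem ae_projPerp_mem_interior {A : Set (perp v)} (hA : Convex ℝ A) :
    ∀ᵐ x : EuclideanSpace ℝ (Fin n), projPerp v x ∈ A → projPerp v x ∈ interior A := by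
  have hfrontier : ∀ᵐ y : perp v, y ∈ (frontier A)ᶜ :=
    compl_mem_ae_iff.2 (hA.addHaar_frontier volume)
  filter_upwards [(ae_comp_linearMap_mem_iff (projPerp v).toLinearMap volume volume
    (projPerp_surjective v) isClosed_frontier.measurableSet.compl).2 hfrontier] with x hx hxA
  by_contra hxi
  exact hx ⟨subset_closure hxA, hxi⟩

theorem movedBody_ae_eq (hK : Convex ℝ K) (hb : EqOn b β (interior (projPerp v '' K))) (t : ℝ) :
    movedBody K v β t =ᵐ[volume] shear v b (-t) ⁻¹' K := by
  filter_upwards [ae_projPerp_mem_interior (hK.linear_image (projPerp v).toLinearMap)] with x hx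
  rw [movedBody_eq_preimage_shear]
  have hshear (γ : perp v → ℝ) (h : shear v γ (-t) x ∈ K) : b (projPerp v x) = β (projPerp v x) :=
    hb (hx ⟨_, h, projPerp_shear γ (-t) x⟩)
  change (shear v β (-t) x ∈ K) = (shear v b (-t) x ∈ K)
  refine propext ⟨fun h => ?_, fun h => ?_⟩
  · simpa only [shear, hshear β h] using h
  · simpa only [shear, hshear b h] using h

theorem volume_movedBody (hK : Convex ℝ K) (hbm : Measurable b)
    (hb : EqOn b β (interior (projPerp v '' K))) (t : ℝ) :
    volume (movedBody K v β t) = volume K := by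
  rw [measure_congr (movedBody_ae_eq hK hb t),
    (measurePreserving_shear hbm (-t)).measure_preimage (hK.nullMeasurableSet volume)]

theorem IsSymmetricConvexBody.measurableSet (hK : IsSymmetricConvexBody K) : MeasurableSet K :=
  hK.isCompact.measurableSet

theorem IsSymmetricConvexBody.volume_ne_top (hK : IsSymmetricConvexBody K) : volume K ≠ ⊤ :=
  hK.isCompact.measure_ne_top

theorem IsSymmetricConvexBody.volumeReal_pos (hK : IsSymmetricConvexBody K) :
    0 < volume.real K :=
  ENNReal.toReal_pos (Measure.measure_pos_of_nonempty_interior volume hK.interior_nonempty).ne'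
    hK.volume_ne_top

theorem IsSymmetricConvexBody.neg_mem (hK : IsSymmetricConvexBody K)
    {x : EuclideanSpace ℝ (Fin n)} (hx : x ∈ K) : -x ∈ K := by
  rwa [← hK.neg_eq, Set.mem_neg, neg_neg]

theorem IsSRSMovement.neg_mem_movedBody {I : Set ℝ} (hmove : IsSRSMovement K v β I)
    (hK : IsSymmetricConvexBody K) {t : ℝ} {x : EuclideanSpace ℝ (Fin n)}
    (hx : x ∈ movedBody K v β t) : -x ∈ movedBody K v β t := by
  obtain ⟨y, hy, rfl⟩ := hx
  refine ⟨-y, hK.neg_mem hy, ?_⟩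
  simp only [map_neg, hmove.odd _ (mem_image_of_mem _ hy)]
  module

theorem measurePreserving_shear_cond (hK : IsSymmetricConvexBody K) (hbm : Measurable b)
    (hb : EqOn b β (interior (projPerp v '' K))) (t : ℝ) :
    MeasurePreserving (shear v b t) (cond volume K) (cond volume (movedBody K v β t)) := by
  have hpre : shear v b t ⁻¹' (shear v b (-t) ⁻¹' K) = K := by
    ext x
    simp [shear_shear]
  have hrestrict := (measurePreserving_shear hbm t).restrict_preimage
    ((measurePreserving_shear hbm (-t)).measurable hK.measurableSet)
  rw [hpre, ← Measure.restrict_congr_set (movedBody_ae_eq hK.convex hb t)] at hrestrict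
  rw [ProbabilityTheory.cond, ProbabilityTheory.cond, volume_movedBody hK.convex hbm hb t]
  exact hrestrict.smul_measure _

theorem measurable_symHullVolume (K : Set (EuclideanSpace ℝ (Fin n))) :
    Measurable (symHullVolume (N := N) K) :=
  (measurable_measureReal_symHull volume).div_const _

theorem integrable_symHullVolume_rpow (hK : Convex ℝ K) (hneg : ∀ x ∈ K, -x ∈ K)
    (htop : volume K ≠ ⊤) {p : ℝ} (hp : 0 ≤ p) :
    Integrable (fun x : Fin N → EuclideanSpace ℝ (Fin n) => symHullVolume K x ^ p)
      (Measure.pi fun _ => cond volume K) := by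
  have hae : ∀ᵐ x ∂(Measure.pi fun _ : Fin N => cond volume K), ∀ i, x i ∈ K :=
    eventually_all.2 fun i => (Measure.tendsto_eval_ae_ae (i := i)).eventually
      (ae_cond_mem₀ (hK.nullMeasurableSet volume))
  refine Integrable.of_bound ((measurable_symHullVolume K).pow_const p).aestronglyMeasurable 1 ?_
  filter_upwards [hae] with x hx
  have hpos : 0 ≤ symHullVolume K x := div_nonneg measureReal_nonneg measureReal_nonneg
  have hle : symHullVolume K x ≤ 1 := div_le_one_of_le₀
    (measureReal_mono (symHull_subset hK hx fun i => hneg _ (hx i)) htop) measureReal_nonneg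
  rw [Real.norm_of_nonneg (Real.rpow_nonneg hpos p)]
  exact Real.rpow_le_one hpos hle hp

theorem measurePreserving_pi_shear_cond (hK : IsSymmetricConvexBody K) (hbm : Measurable b)
    (hb : EqOn b β (interior (projPerp v '' K))) (t : ℝ) :
    MeasurePreserving (fun (x : Fin N → EuclideanSpace ℝ (Fin n)) i => shear v b t (x i))
      (Measure.pi fun _ => cond volume K)
      (Measure.pi fun _ => cond volume (movedBody K v β t)) :=
  measurePreserving_pi _ _ fun _ => measurePreserving_shear_cond hK hbm hb t

theorem symMoment_movedBody (hK : IsSymmetricConvexBody K) (hbm : Measurable b)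
    (hb : EqOn b β (interior (projPerp v '' K))) (t p : ℝ) :
    symMoment (movedBody K v β t) N p =
      ∫ x : Fin N → EuclideanSpace ℝ (Fin n), symHullVolume K (fun i => shear v b t (x i)) ^ p
        ∂(Measure.pi fun _ => cond volume K) := by
  have hmp := measurePreserving_pi_shear_cond (N := N) hK hbm hb t
  rw [symMoment, ← hmp.map_eq, integral_map hmp.aemeasurable
    ((measurable_symHullVolume _).pow_const p).aestronglyMeasurable]
  simp only [symHullVolume, measureReal_def, volume_movedBody hK.convex hbm hb t]

theorem integrable_symHullVolume_shear_rpow {I : Set ℝ} (hK : IsSymmetricConvexBody K)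
    (hmove : IsSRSMovement K v β I) (hbm : Measurable b)
    (hb : EqOn b β (interior (projPerp v '' K))) {p : ℝ} (hp : 0 ≤ p) {t : ℝ} (ht : t ∈ I) :
    Integrable (fun x : Fin N → EuclideanSpace ℝ (Fin n) =>
      symHullVolume K (fun i => shear v b t (x i)) ^ p) (Measure.pi fun _ => cond volume K) := by
  have hvol := volume_movedBody hK.convex hbm hb t
  have hint := integrable_symHullVolume_rpow (N := N) (hmove.convex_movedBody t ht)
    (fun _ => hmove.neg_mem_movedBody hK) (hvol ▸ hK.volume_ne_top) hp
  convert (measurePreserving_pi_shear_cond hK hbm hb t).integrable_comp_of_integrable hint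
    using 2 with x
  simp only [Function.comp_apply, symHullVolume, measureReal_def, hvol]

theorem convexOn_symMoment_movedBody {I : Set ℝ} (hK : IsSymmetricConvexBody K)
    (hmove : IsSRSMovement K v β I) (hbm : Measurable b)
    (hb : EqOn b β (interior (projPerp v '' K))) {p : ℝ} (hp : 1 ≤ p) :
    ConvexOn ℝ I fun t => symMoment (movedBody K v β t) N p := by
  have hI : Convex ℝ I := hmove.interval.convex
  simp only [symMoment_movedBody hK hbm hb]
  exact convexOn_integral hI
    (.of_forall fun x => (convexOn_symHullVolume_shear_rpow hp K b x).subset (subset_univ I) hI)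
    fun t ht => integrable_symHullVolume_shear_rpow hK hmove hbm hb (zero_le_one.trans hp) ht

theorem symMoment_movedBody_of_linear (hK : IsSymmetricConvexBody K) (hβ : IsLinearSpeed K v β)
    (t p : ℝ) : symMoment (movedBody K v β t) N p = symMoment K N p := by
  obtain ⟨l, hl⟩ := hβ
  rw [symMoment_movedBody hK l.continuous_of_finiteDimensional.measurable
    fun y hy => (hl y (interior_subset hy)).symm, symMoment]
  congr! 3 with x
  exact congrArg (· / volume.real K) (volume_symHull_shear_of_linear l t x)

end MovedBody

section Speed

variable {n : ℕ} {K : Set (EuclideanSpace ℝ (Fin n))} {v : EuclideanSpace ℝ (Fin n)}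
  {β : perp v → ℝ} {I : Set ℝ}

theorem IsSymmetricConvexBody.zero_mem_interior (hK : IsSymmetricConvexBody K) :
    (0 : EuclideanSpace ℝ (Fin n)) ∈ interior K := by
  obtain ⟨x, hx⟩ := hK.interior_nonempty
  simpa using hK.convex.combo_interior_self_mem_interior hx (hK.neg_mem (interior_subset hx))
    (a := 1 / 2) (b := 1 / 2) (by norm_num) (by norm_num) (by norm_num)

theorem image_projPerp_interior_subset (v : EuclideanSpace ℝ (Fin n))
    (K : Set (EuclideanSpace ℝ (Fin n))) :
    projPerp v '' interior K ⊆ interior (projPerp v '' K) :=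
  ((projPerp v).isOpenMap (projPerp_surjective v)).image_interior_subset K

theorem image_projPerp_movedBody (K : Set (EuclideanSpace ℝ (Fin n))) (β : perp v → ℝ) (t : ℝ) :
    projPerp v '' movedBody K v β t = projPerp v '' K := by
  rw [movedBody, image_image]
  exact image_congr fun x _ => projPerp_shear β t x

theorem IsRSMovement.convex (hmove : IsRSMovement K v β I) : Convex ℝ K := by
  simpa [movedBody] using hmove.convex_movedBody 0 hmove.zero_mem

theorem IsSRSMovement.apply_zero (hmove : IsSRSMovement K v β I) (hK : IsSymmetricConvexBody K) :
    β 0 = 0 := by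
  have hodd := hmove.odd 0 ⟨0, interior_subset hK.zero_mem_interior, map_zero _⟩
  rw [neg_zero] at hodd
  linarith

/-- The chord of `L` over `y ∈ v^⊥` in direction `v`, in the coordinate `s ↦ y + s v`. -/
def chord (v : EuclideanSpace ℝ (Fin n)) (L : Set (EuclideanSpace ℝ (Fin n))) (y : perp v) :
    Set ℝ :=
  {s | (y : EuclideanSpace ℝ (Fin n)) + s • v ∈ L}

theorem chord_nonempty {y : perp v} (hy : y ∈ projPerp v '' K) : (chord v K y).Nonempty := by
  obtain ⟨x, hx, rfl⟩ := hy
  obtain ⟨s, hs⟩ := exists_eq_projPerp_add_smul v x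
  refine ⟨s, ?_⟩
  change (projPerp v x : EuclideanSpace ℝ (Fin n)) + s • v ∈ K
  rwa [← hs]

theorem isCompact_chord (hK : IsCompact K) (hv : v ≠ 0) (y : perp v) : IsCompact (chord v K y) :=
  ((Homeomorph.addLeft (y : EuclideanSpace ℝ (Fin n))).isClosedEmbedding.comp
    (isClosedEmbedding_smul_left hv)).isCompact_preimage hK

theorem mem_chord_movedBody {t s : ℝ} {y : perp v} :
    s ∈ chord v (movedBody K v β t) y ↔ s - t * β y ∈ chord v K y := by
  rw [movedBody_eq_preimage_shear]
  change shear v β (-t) (y + s • v) ∈ K ↔ (y : EuclideanSpace ℝ (Fin n)) + (s - t * β y) • v ∈ K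
  rw [shear_coe_add_smul, neg_mul, ← sub_eq_add_neg]

theorem isLeast_chord_movedBody {t a : ℝ} {y : perp v} (ha : IsLeast (chord v K y) a) :
    IsLeast (chord v (movedBody K v β t) y) (a + t * β y) := by
  refine ⟨mem_chord_movedBody.2 (by simpa using ha.1), fun s hs => ?_⟩
  linarith [ha.2 (mem_chord_movedBody.1 hs)]

theorem convexOn_of_isLeast_chord (hK : Convex ℝ K) {f : perp v → ℝ}
    (hf : ∀ y ∈ projPerp v '' K, IsLeast (chord v K y) (f y)) :
    ConvexOn ℝ (projPerp v '' K) f := by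
  have hA : Convex ℝ (projPerp v '' K) := hK.linear_image (projPerp v).toLinearMap
  refine ⟨hA, fun y hy z hz a b ha hb hab => (hf _ (hA hy hz ha hb hab)).2 ?_⟩
  change _ ∈ K
  convert hK (hf y hy).1 (hf z hz).1 ha hb hab using 1
  simp only [Submodule.coe_add, Submodule.coe_smul, smul_eq_mul]
  module

theorem IsRSMovement.continuousOn (hmove : IsRSMovement K v β I) (hK : IsCompact K)
    (hI : I.Nontrivial) : ContinuousOn β (interior (projPerp v '' K)) := by
  have hleast (y : perp v) (hy : y ∈ projPerp v '' K) : ∃ a, IsLeast (chord v K y) a :=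
    (isCompact_chord hK hmove.direction_ne_zero y).exists_isLeast (chord_nonempty hy)
  choose! f hf using hleast
  obtain ⟨t, ht, ht₀⟩ := hI.exists_ne 0
  have hf_cont := (convexOn_of_isLeast_chord hmove.convex hf).continuousOn_interior
  have hft_convex : ConvexOn ℝ (projPerp v '' K) fun y => f y + t * β y := by
    rw [← image_projPerp_movedBody K β t]
    refine convexOn_of_isLeast_chord (hmove.convex_movedBody t ht) fun y hy => ?_
    rw [image_projPerp_movedBody] at hy
    exact isLeast_chord_movedBody (hf y hy)
  refine ((hft_convex.continuousOn_interior.sub hf_cont).const_smul t⁻¹).congr fun y _ => ?_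
  simp [ht₀]

theorem eq_zero_of_forall_add_mem {A : Set ℝ} (hA : IsCompact A) (hne : A.Nonempty) {d : ℝ}
    (hd : ∀ s ∈ A, s + d ∈ A) : d = 0 := by
  obtain ⟨a, ha⟩ := hA.exists_isLeast hne
  obtain ⟨c, hc⟩ := hA.exists_isGreatest hne
  linarith [ha.2 (hd a ha.1), hc.2 (hd c hc.1)]

theorem mem_of_forall_smul_mem {E : Type*} [AddCommGroup E] [Module ℝ E] [TopologicalSpace E]
    [ContinuousSMul ℝ E] {s : Set E} (hs : IsClosed s) {x : E}
    (hx : ∀ r ∈ Ioo (0 : ℝ) 1, r • x ∈ s) : x ∈ s := by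
  have hlim : Tendsto (fun r : ℝ => r • x) (𝓝[<] 1) (𝓝 x) := by
    have hcont : Continuous fun r : ℝ => r • x := by fun_prop
    simpa using (hcont.tendsto 1).mono_left nhdsWithin_le_nhds
  exact hs.mem_of_tendsto hlim (by filter_upwards [Ioo_mem_nhdsLT zero_lt_one] using hx)

theorem IsRSMovement.add_mem_chord (hmove : IsRSMovement K v β I) (hK : IsClosed K)
    (h₀ : 0 ∈ interior K) {l : perp v →ₗ[ℝ] ℝ} (hl : EqOn β l (projPerp v '' interior K))
    {t s : ℝ} (ht : t ∈ I) {y : perp v} (hs : s ∈ chord v K y) :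
    s + t * (β y - l y) ∈ chord v K y := by
  have hzero : 0 ∈ movedBody K v β t :=
    ⟨0, interior_subset h₀, by simp [hl ⟨0, h₀, map_zero _⟩]⟩
  refine mem_of_forall_smul_mem hK fun r hr => ?_
  have hβ : β (r • y) = r * l y := by
    have hint : r • ((y : EuclideanSpace ℝ (Fin n)) + s • v) ∈ interior K := by
      simpa using hmove.convex.combo_interior_self_mem_interior h₀ hs (sub_pos.2 hr.2)
        hr.1.le (sub_add_cancel 1 r)
    rw [hl ⟨_, hint, by rw [map_smul, projPerp_coe_add_smul]⟩, map_smul, smul_eq_mul]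
  have hmem : r • shear v β t (y + s • v) ∈ movedBody K v β t :=
    (hmove.convex_movedBody t ht).smul_mem_of_zero_mem hzero (mem_image_of_mem _ hs)
      ⟨hr.1.le, hr.2.le⟩
  have hpoint : r • shear v β t (y + s • v) =
      (r • y : perp v) + (r * (s + t * β y)) • v := by
    rw [shear_coe_add_smul, smul_add, smul_smul, Submodule.coe_smul]
  rw [hpoint] at hmem
  have hpull := mem_chord_movedBody.1 hmem
  rw [hβ] at hpull
  convert (show _ ∈ K from hpull) using 1
  rw [Submodule.coe_smul]
  module

theorem IsRSMovement.eqOn_of_eqOn_image_interior (hmove : IsRSMovement K v β I)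
    (hK : IsCompact K) (h₀ : 0 ∈ interior K) (hI : I.Nontrivial) {l : perp v →ₗ[ℝ] ℝ}
    (hl : EqOn β l (projPerp v '' interior K)) : EqOn β l (projPerp v '' K) := by
  obtain ⟨t, ht, ht₀⟩ := hI.exists_ne 0
  intro y hy
  have hzero : t * (β y - l y) = 0 :=
    eq_zero_of_forall_add_mem (isCompact_chord hK hmove.direction_ne_zero y) (chord_nonempty hy)
      fun s hs => hmove.add_mem_chord hK.isClosed h₀ hl ht hs
  exact sub_eq_zero.1 ((mul_eq_zero.1 hzero).resolve_left ht₀)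

end Speed

section Nonlinear

open Module

theorem exists_basis_forall_mem_nhds {ι F : Type*} [Finite ι] [AddCommGroup F] [Module ℝ F]
    [TopologicalSpace F] [ContinuousSMul ℝ F] (e : Basis ι ℝ F) {V : Set F} (hV : V ∈ 𝓝 0) :
    ∃ w : Basis ι ℝ F, ∀ i, w i ∈ V := by
  have hsmall : ∀ᶠ c in 𝓝[≠] (0 : ℝ), ∀ i, c • e i ∈ V := by
    refine eventually_all.2 fun i => nhdsWithin_le_nhds ?_
    have hcont : Continuous fun c : ℝ => c • e i := by fun_prop
    exact hcont.continuousAt (by simpa using hV)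
  obtain ⟨c, hc, hc₀⟩ := (hsmall.and self_mem_nhdsWithin).exists
  refine ⟨e.unitsSMul fun _ => Units.mk0 c hc₀, fun i => ?_⟩
  rw [Basis.unitsSMul_apply]
  exact hc i

theorem exists_mem_forall_nhds_exists_basis_constr_ne {ι F : Type*} [Finite ι] [AddCommGroup F]
    [Module ℝ F] [TopologicalSpace F] [ContinuousSMul ℝ F] (e : Basis ι ℝ F) {U : Set F}
    (hU : U ∈ 𝓝 0) {β : F → ℝ} (hβ : ∀ l : F →ₗ[ℝ] ℝ, ¬ EqOn β l U) :
    ∃ y ∈ U, ∀ V ∈ 𝓝 (0 : F), ∃ w : Basis ι ℝ F,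
      (∀ i, w i ∈ V) ∧ w.constr ℝ (β ∘ w) y ≠ β y := by
  by_contra! hcontra
  choose! V hV hconstr using hcontra
  obtain ⟨w₀, hw₀⟩ := exists_basis_forall_mem_nhds e hU
  refine hβ (w₀.constr ℝ (β ∘ w₀)) fun y hy => ?_
  obtain ⟨w, hw⟩ := exists_basis_forall_mem_nhds e
    (inter_mem (hV y hy) (iInter_mem.2 fun i => hV (w₀ i) (hw₀ i)))
  have heq : w.constr ℝ (β ∘ w) = w₀.constr ℝ (β ∘ w₀) := w₀.ext fun i => by
    rw [hconstr _ (hw₀ i) w fun j => mem_iInter.1 (hw j).2 i, Basis.constr_basis,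
      Function.comp_apply]
  rw [← heq, hconstr y hy w fun j => (hw j).1]

variable {n : ℕ} {v : EuclideanSpace ℝ (Fin n)}

/-- The parametrization `y ↦ y + l(y) v` of the graph over `v^⊥` of a linear functional `l`. -/
noncomputable def graphMap (v : EuclideanSpace ℝ (Fin n)) (l : perp v →ₗ[ℝ] ℝ) :
    perp v →ₗ[ℝ] EuclideanSpace ℝ (Fin n) :=
  (perp v).subtype + l.smulRight v

theorem graphMap_apply (l : perp v →ₗ[ℝ] ℝ) (y : perp v) : graphMap v l y = y + l y • v :=
  rfl

theorem add_smul_mem_range_graphMap_iff (hv : v ≠ 0) (l : perp v →ₗ[ℝ] ℝ) (y : perp v) (s : ℝ) :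
    (y : EuclideanSpace ℝ (Fin n)) + s • v ∈ (graphMap v l).range ↔ s = l y := by
  refine ⟨fun ⟨z, hz⟩ => ?_, fun h => ⟨y, by rw [h, graphMap_apply]⟩⟩
  obtain rfl : z = y := by
    rw [← projPerp_coe_add_smul z (l z), ← graphMap_apply, hz, projPerp_coe_add_smul]
  exact (smul_left_injective ℝ hv (add_left_cancel hz)).symm

theorem range_graphMap_ne_top (hv : v ≠ 0) (l : perp v →ₗ[ℝ] ℝ) : (graphMap v l).range ≠ ⊤ := by
  intro htop
  have hmem := (add_smul_mem_range_graphMap_iff hv l 0 1).1 (htop ▸ Submodule.mem_top)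
  simp at hmem

theorem injective_graphMap (l : perp v →ₗ[ℝ] ℝ) : Function.Injective (graphMap v l) :=
  Function.LeftInverse.injective (g := projPerp v) fun y => by
    rw [graphMap_apply, projPerp_coe_add_smul]

variable {ι : Type*}

theorem linearIndependent_add_smul_of_constr_ne (hv : v ≠ 0) (w : Basis ι ℝ (perp v))
    {q : perp v → ℝ} {y : perp v} (hy : w.constr ℝ (q ∘ w) y ≠ q y) :
    LinearIndependent ℝ fun o : Option ι =>
      ((o.elim y w : perp v) : EuclideanSpace ℝ (Fin n)) + q (o.elim y w) • v := by
  have hgraph (i : ι) : (w i : EuclideanSpace ℝ (Fin n)) + q (w i) • v =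
      graphMap v (w.constr ℝ (q ∘ w)) (w i) := by
    rw [graphMap_apply, Basis.constr_basis, Function.comp_apply]
  refine linearIndependent_option.2 ⟨?_, fun hspan => hy ?_⟩
  · simp only [Function.comp_def, Option.elim, hgraph]
    exact w.linearIndependent.map_injOn _ (injective_graphMap _).injOn
  · refine ((add_smul_mem_range_graphMap_iff hv _ _ _).1 (Submodule.span_le.2 ?_ hspan)).symm
    rintro _ ⟨i, rfl⟩
    exact ⟨w i, (hgraph i).symm⟩

theorem exists_linearIndependent_shear_of_ne [Finite ι] (hv : v ≠ 0) (e : Basis ι ℝ (perp v))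
    {U : Set (EuclideanSpace ℝ (Fin n))} (hU : U ∈ 𝓝 0) {β : perp v → ℝ}
    (hβ : ContinuousAt β 0) (hβ₀ : β 0 = 0)
    (hlin : ∀ l : perp v →ₗ[ℝ] ℝ, ¬ EqOn β l (projPerp v '' U)) (c : ℝ) :
    ∃ x : Option ι → EuclideanSpace ℝ (Fin n), (∀ o, x o ∈ U) ∧
      (∃ H : Submodule ℝ (EuclideanSpace ℝ (Fin n)), H ≠ ⊤ ∧ ∀ o, shear v β c (x o) ∈ H) ∧
      ∀ s ≠ c, LinearIndependent ℝ fun o => shear v β s (x o) := by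
  have hπU : projPerp v '' U ∈ 𝓝 0 := by
    simpa using ((projPerp v).isOpenMap (projPerp_surjective v)).image_mem_nhds hU
  obtain ⟨y, ⟨x₀, hx₀, hx₀y⟩, hy⟩ := exists_mem_forall_nhds_exists_basis_constr_ne e hπU hlin
  obtain ⟨a, ha⟩ := exists_eq_projPerp_add_smul v x₀
  rw [hx₀y] at ha
  have hy₀ : y ≠ 0 := by
    rintro rfl
    obtain ⟨w, -, hw⟩ := hy univ univ_mem
    exact hw (by rw [map_zero, hβ₀])
  obtain ⟨f, hf⟩ := SeparatingDual.exists_eq_one (R := ℝ) hy₀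
  -- The slope of `h` is chosen so that the lift of `y` below is the point `x₀` of `U`.
  let h : perp v →L[ℝ] ℝ := (a + c * β y) • f
  let lift (z : perp v) : EuclideanSpace ℝ (Fin n) := z + (h z - c * β z) • v
  have hlift : ∀ᶠ z in 𝓝 0, lift z ∈ U := by
    have hcont : ContinuousAt lift 0 := by fun_prop
    exact hcont (by simpa [lift, hβ₀] using hU)
  obtain ⟨w, hwU, hw⟩ := hy _ hlift
  have hshear (s : ℝ) (z : perp v) : shear v β s (lift z) = z + (h z + (s - c) * β z) • v := by
    rw [shear_coe_add_smul, sub_mul, sub_add_eq_add_sub, add_sub_assoc]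
  refine ⟨fun o => lift (o.elim y w), ?_, ⟨_, range_graphMap_ne_top hv h, fun o => ?_⟩, ?_⟩
  · rintro (_ | i)
    · simpa [lift, h, hf, ← ha] using hx₀
    · exact hwU i
  · rw [hshear, add_smul_mem_range_graphMap_iff hv]
    simp
  · intro s hs
    simp only [hshear]
    refine linearIndependent_add_smul_of_constr_ne hv w (q := fun z => h z + (s - c) * β z) ?_
    have hconstr : w.constr ℝ ((fun z => h z + (s - c) * β z) ∘ w) =
        (h : perp v →ₗ[ℝ] ℝ) + (s - c) • w.constr ℝ (β ∘ w) :=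
      w.ext fun i => by simp [Basis.constr_basis]
    simpa [hconstr, sub_eq_zero, hs] using hw

end Nonlinear

section Strictness

variable {n N : ℕ} {K U : Set (EuclideanSpace ℝ (Fin n))} {v : EuclideanSpace ℝ (Fin n)}
  {β b : perp v → ℝ}

theorem continuousAt_shear {x : EuclideanSpace ℝ (Fin n)} (hβ : ContinuousAt β (projPerp v x))
    (t : ℝ) : ContinuousAt (shear v β t) x := by
  have hcomp : ContinuousAt (fun x => β (projPerp v x)) x :=
    hβ.comp (projPerp v).continuous.continuousAt
  exact continuousAt_id.add ((continuousAt_const.mul hcomp).smul continuousAt_const)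

theorem card_option_fin_finrank_perp (hv : v ≠ 0) :
    Fintype.card (Option (Fin (Module.finrank ℝ (perp v)))) = n := by
  have hfinrank := (Submodule.span ℝ {v}).finrank_add_finrank_orthogonal
  rw [finrank_span_singleton hv, finrank_euclideanSpace_fin] at hfinrank
  rw [Fintype.card_option, Fintype.card_fin, add_comm, hfinrank]

theorem exists_eventually_volume_symHull_shear_lt (hv : v ≠ 0) (hN : n ≤ N) (hU : IsOpen U)
    (h₀ : 0 ∈ U) (hβ : ContinuousOn β (projPerp v '' U)) (hβ₀ : β 0 = 0)
    (hlin : ∀ l : perp v →ₗ[ℝ] ℝ, ¬ EqOn β l (projPerp v '' U)) (c : ℝ) :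
    ∃ x : Fin N → EuclideanSpace ℝ (Fin n), (∀ i, x i ∈ U) ∧ ∀ s ≠ c, ∀ l : ℝ, 0 < l →
      ∀ᶠ x' in 𝓝 x, volume.real (symHull fun i => shear v β c (x' i)) <
        l * volume.real (symHull fun i => shear v β s (x' i)) := by
  have hcont {z : EuclideanSpace ℝ (Fin n)} (hz : z ∈ U) : ContinuousAt β (projPerp v z) :=
    hβ.continuousAt <|
      ((projPerp v).isOpenMap (projPerp_surjective v) U hU).mem_nhds (mem_image_of_mem _ hz)
  have hcont₀ : ContinuousAt β 0 := by simpa using hcont h₀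
  obtain ⟨u, huU, ⟨H, hH, huH⟩, hind⟩ := exists_linearIndependent_shear_of_ne hv
    (Module.finBasis ℝ (perp v)) (hU.mem_nhds h₀) hcont₀ hβ₀ hlin c
  have hcard := card_option_fin_finrank_perp hv
  obtain ⟨e⟩ : Nonempty (Option (Fin (Module.finrank ℝ (perp v))) ↪ Fin N) :=
    Function.Embedding.nonempty_of_card_le (by simpa only [hcard, Fintype.card_fin] using hN)
  have hextend (P : EuclideanSpace ℝ (Fin n) → Prop) (h : ∀ o, P (u o)) (h' : P 0) (i : Fin N) :
      P (Function.extend e u 0 i) := by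
    rcases em (∃ o, e o = i) with ⟨o, rfl⟩ | hi
    · simpa only [e.injective.extend_apply] using h o
    · simpa only [Function.extend_apply' _ _ _ hi, Pi.zero_apply] using h'
  have hxU := hextend (· ∈ U) huU h₀
  refine ⟨Function.extend e u 0, hxU, fun s hs l hl => ?_⟩
  have hshear (t : ℝ) : Tendsto (fun x' i => shear v β t (x' i)) (𝓝 (Function.extend e u 0))
      (𝓝 fun i => shear v β t (Function.extend e u 0 i)) :=
    tendsto_pi_nhds.2 fun i =>
      (continuousAt_shear (hcont (hxU i)) t).tendsto.comp ((continuous_apply i).tendsto _)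
  refine eventually_measureReal_symHull_lt_mul volume (hshear c) (hshear s) hH
    (hextend (shear v β c · ∈ H) huH (by simp [shear, hβ₀]))
    (basisOfLinearIndependentOfCardEqFinrank (hind s hs) (by simp [hcard])) (e := e) ?_ hl
  ext1 o
  simp [e.injective.extend_apply]

theorem symHullVolume_shear_rpow_lt {p : ℝ} (hp : 1 ≤ p) (hpos : 0 < volume.real K)
    {x : Fin N → EuclideanSpace ℝ (Fin n)} {s t l r : ℝ} (hl : 0 ≤ l) (hr : 0 ≤ r)
    (hlr : l + r = 1)
    (hlt : volume.real (symHull fun i => shear v β (l * s + r * t) (x i)) <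
      l * volume.real (symHull fun i => shear v β s (x i))) :
    symHullVolume K (fun i => shear v β (l * s + r * t) (x i)) ^ p <
      l * symHullVolume K (fun i => shear v β s (x i)) ^ p +
        r * symHullVolume K (fun i => shear v β t (x i)) ^ p := by
  have hnonneg (y : Fin N → EuclideanSpace ℝ (Fin n)) : 0 ≤ symHullVolume K y :=
    div_nonneg measureReal_nonneg measureReal_nonneg
  have hlt' : symHullVolume K (fun i => shear v β (l * s + r * t) (x i)) <
      l * symHullVolume K (fun i => shear v β s (x i)) +
        r * symHullVolume K (fun i => shear v β t (x i)) := by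
    refine lt_add_of_lt_of_nonneg ?_ (mul_nonneg hr (hnonneg _))
    rw [symHullVolume, symHullVolume, ← mul_div_assoc]
    exact div_lt_div_of_pos_right hlt hpos
  exact (Real.rpow_lt_rpow (hnonneg _) hlt' (by positivity)).trans_le
    ((convexOn_rpow hp).2 (hnonneg _) (hnonneg _) hl hr hlr)

theorem frequently_ae_pi_cond_of_eventually_nhds {ι E : Type*} [Fintype ι] [TopologicalSpace E]
    [MeasurableSpace E] {μ : Measure E} [μ.IsOpenPosMeasure] {K : Set E} (hK : MeasurableSet K)
    (htop : μ K ≠ ⊤) {x : ι → E} (hx : ∀ i, x i ∈ interior K) {P : (ι → E) → Prop}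
    (hP : ∀ᶠ x' in 𝓝 x, P x') : ∃ᶠ x' in ae (Measure.pi fun _ => cond μ K), P x' := by
  rw [nhds_pi] at hP
  obtain ⟨J, -, V, hV, hJV⟩ := Filter.mem_pi.1 hP
  have hfactor (i : ι) : cond μ K (V i) ≠ 0 := by
    rw [ProbabilityTheory.cond_apply hK]
    have hnhds : K ∩ V i ∈ 𝓝 (x i) := inter_mem (mem_interior_iff_mem_nhds.1 (hx i)) (hV i)
    exact mul_ne_zero (ENNReal.inv_ne_zero.2 htop) (Measure.measure_pos_of_mem_nhds μ hnhds).ne'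
  have hbox : Measure.pi (fun _ => cond μ K) (univ.pi V) ≠ 0 := by
    rw [Measure.pi_pi]
    exact Finset.prod_ne_zero_iff.2 fun i _ => hfactor i
  exact frequently_ae_iff.2 fun hzero =>
    hbox (measure_mono_null ((pi_mono' (fun i _ => Subset.rfl) (subset_univ J)).trans hJV) hzero)

theorem strictConvexOn_symMoment_movedBody {I : Set ℝ} (hK : IsSymmetricConvexBody K)
    (hmove : IsSRSMovement K v β I) (hbm : Measurable b)
    (hb : EqOn b β (interior (projPerp v '' K))) (hN : n ≤ N) {p : ℝ} (hp : 1 ≤ p)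
    (hI : I.Nontrivial) (hlin : ¬ IsLinearSpeed K v β) :
    StrictConvexOn ℝ I fun t => symMoment (movedBody K v β t) N p := by
  have hconv : Convex ℝ I := hmove.interval.convex
  have hzero := hK.zero_mem_interior
  have hb' := hb.mono (image_projPerp_interior_subset v K)
  have hb_cont : ContinuousOn b (projPerp v '' interior K) :=
    ((hmove.continuousOn hK.isCompact hI).mono (image_projPerp_interior_subset v K)).congr hb'
  have hb₀ : b 0 = 0 := (hb' ⟨0, hzero, map_zero _⟩).trans (hmove.apply_zero hK)
  have hb_lin (l : perp v →ₗ[ℝ] ℝ) : ¬ EqOn b l (projPerp v '' interior K) := fun hl =>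
    hlin ⟨l, hmove.eqOn_of_eqOn_image_interior hK.isCompact hzero hI (hb'.symm.trans hl)⟩
  simp only [symMoment_movedBody hK hbm hb]
  refine strictConvexOn_integral hconv (.of_forall fun x =>
      (convexOn_symHullVolume_shear_rpow hp K b x).subset (subset_univ I) hconv)
    (fun t ht => integrable_symHullVolume_shear_rpow hK hmove hbm hb (zero_le_one.trans hp) ht)
    fun s _ t _ hst l r hl hr hlr => ?_
  have hs : s ≠ l * s + r * t := fun h => hst <| mul_left_cancel₀ hr.ne' <| by
    linear_combination h + s * hlr
  obtain ⟨x, hx, hlt⟩ := exists_eventually_volume_symHull_shear_lt hmove.direction_ne_zero hN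
    isOpen_interior hzero hb_cont hb₀ hb_lin (l * s + r * t)
  refine frequently_ae_pi_cond_of_eventually_nhds hK.measurableSet hK.volume_ne_top hx
    ((hlt s hs l hl).mono fun x' hx' => ?_)
  exact symHullVolume_shear_rpow_lt hp hK.volumeReal_pos hl.le hr.le hlr hx'

end Strictness

theorem mainTheorem2 {n : ℕ} (hn : 2 ≤ n) (K : Set (EuclideanSpace ℝ (Fin n)))
    (hK : IsSymmetricConvexBody K) (v : EuclideanSpace ℝ (Fin n)) (β : perp v → ℝ)
    (I : Set ℝ) (hI : I.Nontrivial) (hmove : IsSRSMovement K v β I)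
    (p : ℝ) (hp : 1 ≤ p) (N : ℕ) (hN : n ≤ N) :
    ConvexOn ℝ I (fun t => symMoment (movedBody K v β t) N p) ∧
      (StrictConvexOn ℝ I (fun t => symMoment (movedBody K v β t) N p) ↔
        ¬ IsLinearSpeed K v β) := by
  classical
  -- `β` is arbitrary over the boundary of `π_v K`, a null set, and need not be measurable there.
  have hmeas : Measurable ((interior (projPerp v '' K)).indicator β) :=
    (hmove.continuousOn hK.isCompact hI).measurable_piecewise continuousOn_const
      isOpen_interior.measurableSet
  have heq : EqOn ((interior (projPerp v '' K)).indicator β) β (interior (projPerp v '' K)) :=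
    eqOn_indicator
  refine ⟨convexOn_symMoment_movedBody hK hmove hmeas heq hp, fun hstrict hlin => ?_,
    strictConvexOn_symMoment_movedBody hK hmove hmeas heq hN hp hI⟩
  obtain ⟨s, hs, t, ht, hst⟩ := hI
  have hlt := hstrict.2 hs ht hst one_half_pos one_half_pos (add_halves 1)
  simp only [symMoment_movedBody_of_linear hK hlin, smul_eq_mul] at hlt
  linarith
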